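/- Let $M$ be a smooth four-dimensional manifold with a smooth base field $(E_\alpha)_{0\le\alpha\le3}$ of $TM$ and its dual cobase field $(g^\alpha)$ of smooth $1$-forms, $g^\alpha(E_\beta)=\delta^\alpha_\beta$. Put $\eta=\mathrm{diag}(-1,1,1,1)$, $g_\alpha=\eta_{\alpha\beta}g^\beta$, let $\mathbf g=\eta_{\alpha\beta}\,g^\alpha\otimes g^\beta$ be the induced Lorentzian metric and $\tau=g^0\wedge g^1\wedge g^2\wedge g^3$ the orientation; repeated indices are summed. Let $\langle\cdot|\cdot\rangle$ be the product of $p$-forms induced by $\mathbf g$, $\langle\omega|\chi\rangle=\frac1{p!}\omega^{\alpha_1\dots\alpha_p}\chi_{\alpha_1\dots\alpha_p}$; let $\star$ be the Hodge dual, $\chi\wedge\star\omega=\langle\chi|\omega\rangle\tau$; let $\delta=-\star d\star$ be the codifferential and $\square=d\delta+\delta d$. Let $i_\alpha$ be the contraction with $E_\alpha$ and, for a $p$-form $\omega$ and a $(p+q)$-form $\chi$, let $i_\omega\chi$ be the $q$-form $\frac1{p!}\omega^{\alpha_1\dots\alpha_p}\chi(E_{\alpha_1},\dots,E_{\alpha_p},\cdot,\dots,\cdot)$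 (so $i_{a\wedge b}=i_b i_a$ for $1$-forms $a,b$). Let $$\mathcal T_\alpha=\tfrac12\star\left(dg_\beta\wedge i_\alpha\star dg^\beta-i_\alpha dg_\beta\wedge\star dg^\beta\right)+\tfrac12\,\delta g_\beta\wedge\delta g^\beta\wedge g_\alpha+i_\beta d\delta g^\beta\wedge g_\alpha-i_\alpha d\delta g^\beta\wedge g_\beta$$ be the gravitational energy-momentum currents, and let $(\mathcal J_\alpha)_{0\le\alpha\le3}$ be smooth $1$-forms (the matter currents). Suppose that the potentials satisfy the Lorenz gauge $\delta g_\alpha=0$ for $0\le\alpha\le3$. Then, for each $\alpha$, the gravitational field equation $$\delta dg_\alpha=\mathcal T_\alpha+\mathcal J_\alpha$$ holds if and only if the Proca equation $$\square g_\alpha+\tfrac12\langle dg_\beta|dg^\beta\rangle\,g_\alpha=i_{dg_\beta}\left(g_\alpha\wedge dg^\beta\right)+\mathcal J_\alpha$$ holds; that is, the field equations become this coupled system of four Proca equations. -/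

import Mathlib

open scoped Manifold ContDiff

noncomputable section

namespace ProcaGravity

/-! ### Pointwise exterior algebra -/

section Pointwise

variable {V : Type*} [AddCommGroup V] [Module ℝ V] [TopologicalSpace V]

/-- The tensor product `(v₁, …, v_{p+q}) ↦ w(v₁, …, v_p) · χ(v_{p+1}, …, v_{p+q})`. -/
def tensorForm {p q : ℕ} (w : V [⋀^Fin p]→L[ℝ] ℝ) (χ : V [⋀^Fin q]→L[ℝ] ℝ) :
    ContinuousMultilinearMap ℝ (fun _ : Fin (p + q) => V) ℝ where
  toFun v := w (fun i => v (Fin.castAdd q i)) * χ (fun j => v (Fin.natAdd p j))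
  map_update_add' := by
    intro _ v i x y
    induction i using Fin.addCases with
    | left i =>
      have h1 : ∀ z : V, (fun k => Function.update v (Fin.castAdd q i) z (Fin.castAdd q k)) =
          Function.update (fun k => v (Fin.castAdd q k)) i z := fun z =>
        Function.update_comp_eq_of_injective v (Fin.castAdd_injective p q) i z
      have h2 : ∀ z : V, (fun k => Function.update v (Fin.castAdd q i) z (Fin.natAdd p k)) =
          fun k => v (Fin.natAdd p k) := fun z =>
        funext fun k => Function.update_of_ne (by simp [Fin.ext_iff]; omega) _ _
      simp only [h1, h2, ContinuousAlternatingMap.map_update_add, add_mul]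
    | right i =>
      have h1 : ∀ z : V, (fun k => Function.update v (Fin.natAdd p i) z (Fin.natAdd p k)) =
          Function.update (fun k => v (Fin.natAdd p k)) i z := fun z =>
        Function.update_comp_eq_of_injective v (Fin.natAdd_injective q p) i z
      have h2 : ∀ z : V, (fun k => Function.update v (Fin.natAdd p i) z (Fin.castAdd q k)) =
          fun k => v (Fin.castAdd q k) := fun z =>
        funext fun k => Function.update_of_ne (by simp [Fin.ext_iff]; omega) _ _
      simp only [h1, h2, ContinuousAlternatingMap.map_update_add, mul_add]
  map_update_smul' := by
    intro _ v i c x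
    induction i using Fin.addCases with
    | left i =>
      have h1 : ∀ z : V, (fun k => Function.update v (Fin.castAdd q i) z (Fin.castAdd q k)) =
          Function.update (fun k => v (Fin.castAdd q k)) i z := fun z =>
        Function.update_comp_eq_of_injective v (Fin.castAdd_injective p q) i z
      have h2 : ∀ z : V, (fun k => Function.update v (Fin.castAdd q i) z (Fin.natAdd p k)) =
          fun k => v (Fin.natAdd p k) := fun z =>
        funext fun k => Function.update_of_ne (by simp [Fin.ext_iff]; omega) _ _
      simp only [h1, h2, ContinuousAlternatingMap.map_update_smul, smul_eq_mul, mul_assoc]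
    | right i =>
      have h1 : ∀ z : V, (fun k => Function.update v (Fin.natAdd p i) z (Fin.natAdd p k)) =
          Function.update (fun k => v (Fin.natAdd p k)) i z := fun z =>
        Function.update_comp_eq_of_injective v (Fin.natAdd_injective q p) i z
      have h2 : ∀ z : V, (fun k => Function.update v (Fin.natAdd p i) z (Fin.castAdd q k)) =
          fun k => v (Fin.castAdd q k) := fun z =>
        funext fun k => Function.update_of_ne (by simp [Fin.ext_iff]; omega) _ _
      simp only [h1, h2, ContinuousAlternatingMap.map_update_smul, smul_eq_mul, mul_left_comm]
  cont := by
    refine (w.cont.comp ?_).mul (χ.cont.comp ?_) <;> fun_prop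

/-- The wedge product of two alternating forms,
`(w ∧ χ)(v) = (1 / (p! q!)) ∑_σ sign(σ) w(v_{σ 1}, …, v_{σ p}) χ(v_{σ (p+1)}, …, v_{σ (p+q)})`;
thus `(a ∧ b)(u, v) = a(u) b(v) - a(v) b(u)` for one-forms. -/
def wedgeAt {p q : ℕ} (w : V [⋀^Fin p]→L[ℝ] ℝ) (χ : V [⋀^Fin q]→L[ℝ] ℝ) :
    V [⋀^Fin (p + q)]→L[ℝ] ℝ :=
  ((p.factorial * q.factorial : ℝ)⁻¹) •
    ContinuousMultilinearMap.alternatization (tensorForm w χ)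

/-- The contraction `(i_X w)(v₁, …, v_q) = w(X, v₁, …, v_q)` of a form with a vector. -/
def interiorAt {q : ℕ} (X : V) (w : V [⋀^Fin (q + 1)]→L[ℝ] ℝ) : V [⋀^Fin q]→L[ℝ] ℝ :=
  { w.toAlternatingMap.curryLeft X with
    cont := w.cont.comp (continuous_const.finCons continuous_id) }

/-- The iterated contraction `i_{X_p} ⋯ i_{X_1} w`, i.e. `v ↦ w(X_1, …, X_p, v_1, …, v_q)`. -/
def multiInteriorAt {q : ℕ} : (p : ℕ) → (Fin p → V) → V [⋀^Fin (q + p)]→L[ℝ] ℝ →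
    V [⋀^Fin q]→L[ℝ] ℝ
  | 0, _, w => w
  | p + 1, X, w => multiInteriorAt p (Fin.tail X) (interiorAt (X 0) w)

end Pointwise

/-! ### Differential forms on a four-dimensional manifold -/

/-- The model space of a four-dimensional manifold. -/
abbrev E4 : Type := EuclideanSpace ℝ (Fin 4)

section Manifold

variable (M : Type*) [TopologicalSpace M] [ChartedSpace E4 M]

/-- A (not necessarily smooth) differential form of degree `p` on `M`. -/
abbrev Form (p : ℕ) : Type _ := (x : M) → (TangentSpace (𝓡 4) x) [⋀^Fin p]→L[ℝ] ℝ

variable {M}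

/-- The expression of a form in the chart centred at `x₀`: the pull-back of `w` under the inverse
of this chart. Its values matter only on the target of the chart. -/
def inChart {p : ℕ} (w : Form M p) (x₀ : M) (y : E4) : E4 [⋀^Fin p]→L[ℝ] ℝ :=
  (w ((extChartAt (𝓡 4) x₀).symm y)).compContinuousLinearMap
    (mfderiv 𝓘(ℝ, E4) (𝓡 4) (extChartAt (𝓡 4) x₀).symm y : E4 →L[ℝ] _)

/-- A form is smooth if its expressions in charts are smooth. -/
def IsSmooth {p : ℕ} (w : Form M p) : Prop :=
  ∀ x₀ : M, ContDiffOn ℝ ∞ (inChart w x₀) (extChartAt (𝓡 4) x₀).target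

/-- The exterior derivative, computed at each point in the chart centred there. -/
def extd {p : ℕ} (w : Form M p) : Form M (p + 1) := fun x =>
  (extDeriv (inChart w x) (extChartAt (𝓡 4) x x)).compContinuousLinearMap
    (mfderiv (𝓡 4) 𝓘(ℝ, E4) (extChartAt (𝓡 4) x) x : TangentSpace (𝓡 4) x →L[ℝ] E4)

/-- The wedge product of differential forms. -/
def wedge {p q : ℕ} (w : Form M p) (χ : Form M q) : Form M (p + q) :=
  fun x => wedgeAt (w x) (χ x)

/-- The contraction of a differential form with a vector field. -/
def interior {p : ℕ} (X : (x : M) → TangentSpace (𝓡 4) x) (w : Form M (p + 1)) :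
    Form M p :=
  fun x => interiorAt (X x) (w x)

/-- The diagonal entries of `η = diag(-1, 1, 1, 1)`; since `η = η⁻¹`, they serve both to lower
and to raise an index. -/
def eta : Fin 4 → ℝ := ![-1, 1, 1, 1]

variable (M) in
/-- A smooth base field `(E_α)` on `M` together with its cobase field `(g^α)`. The four vectors
`E_α(x)` are automatically a basis of the tangent space, whose dimension is four. -/
structure Cobase [IsManifold (𝓡 4) ∞ M] where
  /-- the base field `E_α` -/
  E : Fin 4 → (x : M) → TangentSpace (𝓡 4) x
  /-- the cobase field `g^α` -/
  up : Fin 4 → Form M 1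
  smooth_E : ∀ α, ContMDiff (𝓡 4) (𝓡 4).tangent ∞
    (fun x => (⟨x, E α x⟩ : TangentBundle (𝓡 4) M))
  smooth_up : ∀ α, IsSmooth (up α)
  dual : ∀ α β x, up α x ![E β x] = if α = β then 1 else 0

namespace Cobase

variable [IsManifold (𝓡 4) ∞ M] (g : Cobase M)

/-- The potentials with lowered index, `g_α = η_{αβ} g^β`. -/
def low (α : Fin 4) : Form M 1 := eta α • g.up α

/-- The volume form `τ = g⁰ ∧ g¹ ∧ g² ∧ g³`. -/
def vol : Form M 4 := wedge (wedge (wedge (g.up 0) (g.up 1)) (g.up 2)) (g.up 3)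

/-- The product `⟨w|χ⟩ = (1/p!) w^{α₁…α_p} χ_{α₁…α_p}` of two `p`-forms, indices being raised by
the metric `η_{αβ} g^α ⊗ g^β`, for which `(E_α)` is orthonormal. -/
def inner {p : ℕ} (w χ : Form M p) : M → ℝ := fun x =>
  ((p.factorial : ℝ)⁻¹) * ∑ a : Fin p → Fin 4,
    (∏ k, eta (a k)) * w x (fun k => g.E (a k) x) * χ x (fun k => g.E (a k) x)

/-- The contraction `i_w χ` of a `(q+p)`-form `χ` with a `p`-form `w`,
`(i_w χ)(v) = (1/p!) w^{α₁…α_p} χ(E_{α₁}, …, E_{α_p}, v₁, …, v_q)`, so that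
`i_{a ∧ b} = i_b i_a` for one-forms `a`, `b` and `i_{a ∧ b} χ = ⟨a ∧ b|χ⟩` for a two-form `χ`. -/
def contract {p q : ℕ} (w : Form M p) (χ : Form M (q + p)) : Form M q := fun x =>
  ((p.factorial : ℝ)⁻¹) • ∑ a : Fin p → Fin 4,
    ((∏ k, eta (a k)) * w x (fun k => g.E (a k) x)) •
      multiInteriorAt p (fun k => g.E (a k) x) (χ x)

/-- The Hodge dual `⋆w = i_w τ`, the `q`-form with `χ ∧ ⋆w = ⟨χ|w⟩ τ` for all `p`-forms `χ`,
where `q + p = 4`. -/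
def hodge {p q : ℕ} (h : q + p = 4) (w : Form M p) : Form M q :=
  g.contract w (h.symm ▸ g.vol)

/-- The codifferential `δ = -⋆d⋆` (for Lorentzian signature in dimension four) from `(p+1)`-forms
to `p`-forms. -/
def codiff {p : ℕ} (hp : p ≤ 3) (w : Form M (p + 1)) : Form M p :=
  -g.hodge (p := (3 - p) + 1) (q := p) (by omega)
    (extd (g.hodge (p := p + 1) (q := 3 - p) (by omega) w))

/-- The Laplace-Beltrami operator `□ = dδ + δd` on forms of degree between one and three. -/
def box {p : ℕ} (hp : p + 1 ≤ 3) (w : Form M (p + 1)) : Form M (p + 1) :=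
  extd (g.codiff (p := p) (by omega) w) + g.codiff (p := p + 1) hp (extd w)

/-- The codifferential `δ g_α` of a potential. -/
def deltaLow (α : Fin 4) : Form M 0 := g.codiff (p := 0) (by norm_num) (g.low α)

/-- The codifferential `δ g^α` of a potential with raised index. -/
def deltaUp (α : Fin 4) : Form M 0 := g.codiff (p := 0) (by norm_num) (g.up α)

/-- The contraction `i_α` with `E_α`. -/
def iota {p : ℕ} (α : Fin 4) (w : Form M (p + 1)) : Form M p := interior (g.E α) w

/-- The Hodge dual of a two-form. -/
def star2 (w : Form M 2) : Form M 2 := g.hodge (p := 2) (q := 2) rfl w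

/-- The Hodge dual of a three-form. -/
def star3 (w : Form M 3) : Form M 1 := g.hodge (p := 3) (q := 1) rfl w

/-- The gravitational energy-momentum currents
`𝒯_α = ½ ⋆(dg_β ∧ i_α ⋆dg^β - i_α dg_β ∧ ⋆dg^β) + ½ δg_β ∧ δg^β ∧ g_α + i_β dδg^β ∧ g_α
  - i_α dδg^β ∧ g_β`, summed over `β`. -/
def gravCurrent (α : Fin 4) : Form M 1 :=
  (1 / 2 : ℝ) • g.star3 (∑ β,
      (wedge (p := 2) (q := 1) (extd (g.low β)) (g.iota α (g.star2 (extd (g.up β))))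
        - wedge (p := 1) (q := 2) (g.iota α (extd (g.low β))) (g.star2 (extd (g.up β)))))
    + ∑ β,
      ((1 / 2 : ℝ) • wedge (p := 0) (q := 1) (wedge (g.deltaLow β) (g.deltaUp β)) (g.low α)
        + wedge (p := 0) (q := 1) (g.iota β (extd (g.deltaUp β))) (g.low α)
        - wedge (p := 0) (q := 1) (g.iota α (extd (g.deltaUp β))) (g.low β))

end Cobase

end Manifold

end ProcaGravity

end

open scoped Manifold ContDiff

noncomputable section

namespace ProcaGravity

/-! In the Lorenz gauge every term of the current containing `δg` vanishes and `□g_α = δdg_α`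
(`gravCurrent_of_lorenz`, `box_of_lorenz`). Both equations then differ only by an algebraic
identity, `current_sum`: the quadratic current plus `½⟨dg_β|dg^β⟩g_α` is `i_{dg_β}(g_α ∧ dg^β)`.

It holds for each `β` separately (`current_two_form`). For two-forms `G`, `F`, contracting `G ∧ ⋆F =
⟨G|F⟩τ` with `E_α` gives `G ∧ i_α⋆F = ⟨G|F⟩ i_ατ - i_αG ∧ ⋆F`. Since `⋆i_ατ = g_α`, the left side
becomes `⟨G|F⟩g_α - ⋆(i_αG ∧ ⋆F)`; and `-⋆(a ∧ ⋆F) = i_aF` for a one-form `a`, which matches the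
expansion of `i_G(g_α ∧ F)`. The formal proof checks this in components: one-forms are determined on
the frame (`ext_frame`), and there `τ` is the Levi-Civita symbol (`vol_frame`). -/

/-- A sum over tuples of length `n + 1` splits off the first entry. -/
theorem sum_tuple_succ {ι : Type*} [Fintype ι] {n : ℕ} (f : (Fin (n + 1) → ι) → ℝ) :
    ∑ a, f a = ∑ i, ∑ b : Fin n → ι, f (Fin.cons i b) := by
  rw [← Fintype.sum_prod_type', ← (Fin.consEquiv fun _ : Fin (n + 1) => ι).sum_comp]
  rfl

/-- Iterating this turns the permutation sum in a wedge product into an explicit sum. -/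
theorem sum_perm_succ {n : ℕ} (f : Equiv.Perm (Fin (n + 1)) → ℝ) :
    ∑ σ, f σ = ∑ i, ∑ σ : Equiv.Perm (Fin n), f (Equiv.Perm.decomposeFin.symm (i, σ)) := by
  rw [← Fintype.sum_prod_type', ← Equiv.Perm.decomposeFin.symm.sum_comp]

theorem vec_one {ι : Type*} (f : Fin 1 → ι) : f = ![f 0] := by
  ext i; fin_cases i; rfl

theorem vec_two {ι : Type*} (f : Fin 2 → ι) : f = ![f 0, f 1] := by
  ext i; fin_cases i <;> rfl

theorem vec_three {ι : Type*} (f : Fin 3 → ι) : f = ![f 0, f 1, f 2] := by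
  ext i; fin_cases i <;> rfl

theorem decomposeFin_symm_two {n : ℕ} (p : Fin (n + 3)) (e : Equiv.Perm (Fin (n + 2))) :
    Equiv.Perm.decomposeFin.symm (p, e) 2 = Equiv.swap 0 p (e 1).succ :=
  Equiv.Perm.decomposeFin_symm_apply_succ e p 1

theorem decomposeFin_symm_three {n : ℕ} (p : Fin (n + 4)) (e : Equiv.Perm (Fin (n + 3))) :
    Equiv.Perm.decomposeFin.symm (p, e) 3 = Equiv.swap 0 p (e 2).succ :=
  Equiv.Perm.decomposeFin_symm_apply_succ e p 2

/-! ### Wedge products in low degree, evaluated on vectors. -/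

section Pointwise

variable {V : Type*} [AddCommGroup V] [Module ℝ V] [TopologicalSpace V]

theorem two_form_swap (w : V [⋀^Fin 2]→L[ℝ] ℝ) (a b : V) : w ![b, a] = -w ![a, b] := by
  refine Eq.trans ?_ (w.toAlternatingMap.map_swap ![a, b] (show (0 : Fin 2) ≠ 1 by decide))
  refine congrArg w ?_
  ext i
  fin_cases i <;> rfl

theorem two_form_self (w : V [⋀^Fin 2]→L[ℝ] ℝ) (a : V) : w ![a, a] = 0 :=
  w.map_eq_zero_of_eq _ (i := 0) (j := 1) rfl (by decide)

theorem three_form_swap_left (w : V [⋀^Fin 3]→L[ℝ] ℝ) (a b c : V) :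
    w ![b, a, c] = -w ![a, b, c] := by
  refine Eq.trans ?_ (w.toAlternatingMap.map_swap ![a, b, c] (show (0 : Fin 3) ≠ 1 by decide))
  refine congrArg w ?_
  ext i
  fin_cases i <;> rfl

theorem three_form_swap_right (w : V [⋀^Fin 3]→L[ℝ] ℝ) (a b c : V) :
    w ![a, c, b] = -w ![a, b, c] := by
  refine Eq.trans ?_ (w.toAlternatingMap.map_swap ![a, b, c] (show (1 : Fin 3) ≠ 2 by decide))
  refine congrArg w ?_
  ext i
  fin_cases i <;> rfl

theorem wedgeAt_apply {p q : ℕ} (w : V [⋀^Fin p]→L[ℝ] ℝ) (χ : V [⋀^Fin q]→L[ℝ] ℝ)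
    (v : Fin (p + q) → V) :
    wedgeAt w χ v = ((p.factorial * q.factorial : ℝ)⁻¹) *
      ∑ σ : Equiv.Perm (Fin (p + q)), (Equiv.Perm.sign σ : ℝ) *
        (w (fun i => v (σ (Fin.castAdd q i))) * χ (fun j => v (σ (Fin.natAdd p j)))) := by
  simp only [wedgeAt, ContinuousAlternatingMap.smul_apply,
    ContinuousMultilinearMap.alternatization_apply_apply, smul_eq_mul]
  congr 1
  refine Finset.sum_congr rfl fun σ _ => ?_
  simp only [Units.smul_def, zsmul_eq_mul]
  rfl

theorem zero_wedgeAt {p q : ℕ} (χ : V [⋀^Fin q]→L[ℝ] ℝ) :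
    wedgeAt (0 : V [⋀^Fin p]→L[ℝ] ℝ) χ = 0 := by
  ext v
  simp [wedgeAt_apply]

theorem wedgeAt_one_one (w : V [⋀^Fin 1]→L[ℝ] ℝ) (χ : V [⋀^Fin 1]→L[ℝ] ℝ) (a b : V) :
    wedgeAt w χ ![a, b] = w ![a] * χ ![b] - w ![b] * χ ![a] := by
  have key : ∀ σ : Equiv.Perm (Fin 2),
      w (fun i => (![a, b] : Fin 2 → V) (σ (Fin.castAdd 1 i))) *
        χ (fun j => (![a, b] : Fin 2 → V) (σ (Fin.natAdd 1 j))) =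
      w ![(![a, b] : Fin 2 → V) (σ 0)] *
        χ ![(![a, b] : Fin 2 → V) (σ 1)] := fun σ => by
    rw [vec_one fun i => (![a, b] : Fin 2 → V) (σ (Fin.castAdd 1 i)),
      vec_one fun i => (![a, b] : Fin 2 → V) (σ (Fin.natAdd 1 i))]
    rfl
  rw [wedgeAt_apply]
  erw [Finset.sum_congr rfl fun σ _ => congrArg _ (key σ)]
  simp only [sum_perm_succ, Fin.sum_univ_succ, Fin.sum_univ_zero]
  simp
  ring

theorem wedgeAt_one_two (w : V [⋀^Fin 1]→L[ℝ] ℝ) (χ : V [⋀^Fin 2]→L[ℝ] ℝ) (a b c : V) :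
    wedgeAt w χ ![a, b, c] = w ![a] * χ ![b, c] - w ![b] * χ ![a, c] + w ![c] * χ ![a, b] := by
  have key : ∀ σ : Equiv.Perm (Fin 3),
      w (fun i => (![a, b, c] : Fin 3 → V) (σ (Fin.castAdd 2 i))) *
        χ (fun j => (![a, b, c] : Fin 3 → V) (σ (Fin.natAdd 1 j))) =
      w ![(![a, b, c] : Fin 3 → V) (σ 0)] *
        χ ![(![a, b, c] : Fin 3 → V) (σ 1), (![a, b, c] : Fin 3 → V) (σ 2)] := fun σ => by
    rw [vec_one fun i => (![a, b, c] : Fin 3 → V) (σ (Fin.castAdd 2 i)),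
      vec_two fun i => (![a, b, c] : Fin 3 → V) (σ (Fin.natAdd 1 i))]
    rfl
  rw [wedgeAt_apply]
  erw [Finset.sum_congr rfl fun σ _ => congrArg _ (key σ)]
  simp only [sum_perm_succ, Fin.sum_univ_succ, Fin.sum_univ_zero]
  simp [decomposeFin_symm_two, Equiv.swap_apply_def, Nat.factorial]
  -- Putting the arguments of `χ` in one order makes equal terms pair up, which cancels the factor
  -- `1/2!`.
  rw [two_form_swap χ b c, two_form_swap χ a c, two_form_swap χ a b]
  ring

theorem wedgeAt_two_one (w : V [⋀^Fin 2]→L[ℝ] ℝ) (χ : V [⋀^Fin 1]→L[ℝ] ℝ) (a b c : V) :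
    wedgeAt w χ ![a, b, c] = w ![a, b] * χ ![c] - w ![a, c] * χ ![b] + w ![b, c] * χ ![a] := by
  have key : ∀ σ : Equiv.Perm (Fin 3),
      w (fun i => (![a, b, c] : Fin 3 → V) (σ (Fin.castAdd 1 i))) *
        χ (fun j => (![a, b, c] : Fin 3 → V) (σ (Fin.natAdd 2 j))) =
      w ![(![a, b, c] : Fin 3 → V) (σ 0), (![a, b, c] : Fin 3 → V) (σ 1)] *
        χ ![(![a, b, c] : Fin 3 → V) (σ 2)] := fun σ => by
    rw [vec_two fun i => (![a, b, c] : Fin 3 → V) (σ (Fin.castAdd 1 i)),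
      vec_one fun i => (![a, b, c] : Fin 3 → V) (σ (Fin.natAdd 2 i))]
    rfl
  rw [wedgeAt_apply]
  erw [Finset.sum_congr rfl fun σ _ => congrArg _ (key σ)]
  simp only [sum_perm_succ, Fin.sum_univ_succ, Fin.sum_univ_zero]
  simp [decomposeFin_symm_two, Equiv.swap_apply_def, Nat.factorial]
  rw [two_form_swap w b c, two_form_swap w a c, two_form_swap w a b]
  ring

theorem wedgeAt_three_one (w : V [⋀^Fin 3]→L[ℝ] ℝ) (χ : V [⋀^Fin 1]→L[ℝ] ℝ) (a b c d : V) :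
    wedgeAt w χ ![a, b, c, d] = w ![a, b, c] * χ ![d] - w ![a, b, d] * χ ![c] +
      w ![a, c, d] * χ ![b] - w ![b, c, d] * χ ![a] := by
  have key : ∀ σ : Equiv.Perm (Fin 4),
      w (fun i => (![a, b, c, d] : Fin 4 → V) (σ (Fin.castAdd 1 i))) *
        χ (fun j => (![a, b, c, d] : Fin 4 → V) (σ (Fin.natAdd 3 j))) =
      w ![(![a, b, c, d] : Fin 4 → V) (σ 0), (![a, b, c, d] : Fin 4 → V) (σ 1), (![a, b, c, d] : Fin 4 → V) (σ 2)] *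
        χ ![(![a, b, c, d] : Fin 4 → V) (σ 3)] := fun σ => by
    rw [vec_three fun i => (![a, b, c, d] : Fin 4 → V) (σ (Fin.castAdd 1 i)),
      vec_one fun i => (![a, b, c, d] : Fin 4 → V) (σ (Fin.natAdd 3 i))]
    rfl
  rw [wedgeAt_apply]
  erw [Finset.sum_congr rfl fun σ _ => congrArg _ (key σ)]
  simp only [sum_perm_succ, Fin.sum_univ_succ, Fin.sum_univ_zero]
  simp [decomposeFin_symm_two, decomposeFin_symm_three, Equiv.swap_apply_def, Nat.factorial]
  simp only [three_form_swap_left w a b, fun z => three_form_swap_right w z a b,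
    three_form_swap_left w a c, fun z => three_form_swap_right w z a c,
    three_form_swap_left w a d, fun z => three_form_swap_right w z a d,
    three_form_swap_left w b c, fun z => three_form_swap_right w z b c,
    three_form_swap_left w b d, fun z => three_form_swap_right w z b d,
    fun z => three_form_swap_right w z c d]
  ring


end Pointwise

/-! ### Linearity of the operators and the frame. -/

section Manifold

variable {M : Type*} [TopologicalSpace M] [ChartedSpace E4 M]

/-- The scalar is constant, so no differentiability of `w` is needed. -/
theorem extd_smul {p : ℕ} (c : ℝ) (w : Form M p) : extd (c • w) = c • extd w := by
  ext x v
  have h : inChart (c • w) x = c • inChart w x := rfl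
  simp only [extd, h, extDeriv_smul]
  rfl

theorem extd_zero {p : ℕ} : extd (0 : Form M p) = 0 := by
  simpa using extd_smul 0 (0 : Form M p)

theorem zero_wedge {p q : ℕ} (χ : Form M q) : wedge (0 : Form M p) χ = 0 :=
  funext fun x => zero_wedgeAt (χ x)

theorem eta_mul_self (α : Fin 4) : eta α * eta α = 1 := by
  fin_cases α <;> simp [eta]

theorem wedge_one_two_apply (w : Form M 1) (χ : Form M 2) (x : M) (a b c : TangentSpace (𝓡 4) x) :
    wedge (p := 1) (q := 2) w χ x ![a, b, c] =
      w x ![a] * χ x ![b, c] - w x ![b] * χ x ![a, c] + w x ![c] * χ x ![a, b] :=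
  wedgeAt_one_two _ _ _ _ _

theorem wedge_two_one_apply (w : Form M 2) (χ : Form M 1) (x : M) (a b c : TangentSpace (𝓡 4) x) :
    wedge (p := 2) (q := 1) w χ x ![a, b, c] =
      w x ![a, b] * χ x ![c] - w x ![a, c] * χ x ![b] + w x ![b, c] * χ x ![a] :=
  wedgeAt_two_one _ _ _ _ _

namespace Cobase

variable [IsManifold (𝓡 4) ∞ M] (g : Cobase M)

theorem up_eq (α : Fin 4) : g.up α = eta α • g.low α := by
  rw [low, smul_smul, eta_mul_self, one_smul]

theorem contract_smul_left {p q : ℕ} (c : ℝ) (w : Form M p) (χ : Form M (q + p)) :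
    g.contract (c • w) χ = c • g.contract w χ := by
  funext x
  have h : ∀ v, (c • w) x v = c * w x v := fun _ => rfl
  simp only [contract, Pi.smul_apply, Finset.smul_sum, smul_smul]
  exact Finset.sum_congr rfl fun a _ => congrArg (· • _) (by erw [h]; ring)

theorem codiff_smul {p : ℕ} (hp : p ≤ 3) (c : ℝ) (w : Form M (p + 1)) :
    g.codiff hp (c • w) = c • g.codiff hp w := by
  simp only [codiff, hodge, contract_smul_left, extd_smul, smul_neg]

theorem linearIndependent_frame (x : M) : LinearIndependent ℝ fun α => g.E α x := by
  rw [Fintype.linearIndependent_iff]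
  intro c hc β
  let L : TangentSpace (𝓡 4) x →ₗ[ℝ] ℝ := (g.up β x).toMultilinearMap.toLinearMap ![0] 0
  have h : ∀ α, L (g.E α x) = if β = α then 1 else 0 := fun α => by
    rw [← g.dual β α x]
    refine congrArg (g.up β x) ?_
    ext i
    fin_cases i
    rfl
  simpa [h] using congrArg L hc

/-- One-forms agreeing on the frame are equal. -/
theorem ext_frame {w χ : Form M 1}
    (h : ∀ x α, w x ![g.E α x] = χ x ![g.E α x]) : w = χ := by
  funext x
  let b : Module.Basis (Fin 4) ℝ (TangentSpace (𝓡 4) x) :=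
    basisOfLinearIndependentOfCardEqFinrank (g.linearIndependent_frame x)
      (by rw [show Module.finrank ℝ (TangentSpace (𝓡 4) x) = Module.finrank ℝ E4 from rfl]; simp)
  refine ContinuousAlternatingMap.toAlternatingMap_injective (b.ext_alternating fun v _ => ?_)
  have hv : (fun i => b (v i)) = ![g.E (v 0) x] := by
    rw [vec_one fun i => b (v i)]
    simp [b]
  rw [hv]
  exact h x (v 0)

/-! ### Volume form, products and contractions in frame components. -/

/-- The Kronecker symbol. -/
def kroneckerDelta (i j : Fin 4) : ℤ := if i = j then 1 else 0

/-- The Levi-Civita symbol. -/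
def leviCivita (a b c d : Fin 4) : ℤ :=
  Matrix.det (Matrix.of fun i j => kroneckerDelta i (![a, b, c, d] j))

/-- By duality, expanding the iterated wedge gives the determinant of the matrix of Kronecker
symbols. -/
theorem vol_frame (x : M) (a b c d : Fin 4) :
    g.vol x ![g.E a x, g.E b x, g.E c x, g.E d x] = leviCivita a b c d := by
  have h : g.vol x = wedgeAt (wedgeAt (wedgeAt (g.up 0 x) (g.up 1 x)) (g.up 2 x)) (g.up 3 x) := rfl
  rw [h]
  erw [wedgeAt_three_one]
  erw [wedgeAt_two_one, wedgeAt_two_one, wedgeAt_two_one, wedgeAt_two_one]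
  have hd : ∀ i j, g.up i x ![g.E j x] = (kroneckerDelta i j : ℝ) := fun i j => by
    rw [g.dual, kroneckerDelta]
    split_ifs <;> simp
  simp only [wedgeAt_one_one, hd, leviCivita, Matrix.det_succ_row_zero, Fin.sum_univ_succ]
  simp [Fin.succAbove]
  ring

theorem prod_eta_two (a : Fin 2 → Fin 4) : ∏ k, eta (a k) = eta (a 0) * eta (a 1) := by
  simp [Fin.prod_univ_succ]

theorem prod_eta_three (a : Fin 3 → Fin 4) :
    ∏ k, eta (a k) = eta (a 0) * eta (a 1) * eta (a 2) := by
  simp [Fin.prod_univ_succ, mul_assoc]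

theorem inner_two (w χ : Form M 2) (x : M) :
    g.inner w χ x = (1 / 2 : ℝ) * ∑ i, ∑ j, eta i * eta j * w x ![g.E i x, g.E j x] *
      χ x ![g.E i x, g.E j x] := by
  have h : ∀ a : Fin 2 → Fin 4, (∏ k, eta (a k)) * w x (fun k => g.E (a k) x) *
      χ x (fun k => g.E (a k) x) = eta (a 0) * eta (a 1) * w x ![g.E (a 0) x, g.E (a 1) x] *
        χ x ![g.E (a 0) x, g.E (a 1) x] := fun a => by
    rw [prod_eta_two, vec_two fun k => g.E (a k) x]
  simp only [inner, h, sum_tuple_succ, Fintype.sum_unique]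
  norm_num

theorem contract_two_one (w : Form M 2) (χ : Form M 3) (x : M) (u : TangentSpace (𝓡 4) x) :
    g.contract (p := 2) (q := 1) w χ x ![u] = (1 / 2 : ℝ) * ∑ i, ∑ j,
      eta i * eta j * w x ![g.E i x, g.E j x] * χ x ![g.E i x, g.E j x, u] := by
  have h : ∀ a : Fin 2 → Fin 4, (∏ k, eta (a k)) * w x (fun k => g.E (a k) x) *
      multiInteriorAt (q := 1) 2 (fun k => g.E (a k) x) (χ x) ![u] =
        eta (a 0) * eta (a 1) * w x ![g.E (a 0) x, g.E (a 1) x] *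
          χ x ![g.E (a 0) x, g.E (a 1) x, u] := fun a => by
    rw [prod_eta_two, vec_two fun k => g.E (a k) x]
    rfl
  simp only [contract, ContinuousAlternatingMap.smul_apply, ContinuousAlternatingMap.sum_apply,
    smul_eq_mul, h, sum_tuple_succ, Fintype.sum_unique]
  norm_num

theorem contract_two_two (w : Form M 2) (χ : Form M 4) (x : M) (u v : TangentSpace (𝓡 4) x) :
    g.contract (p := 2) (q := 2) w χ x ![u, v] = (1 / 2 : ℝ) * ∑ i, ∑ j,
      eta i * eta j * w x ![g.E i x, g.E j x] * χ x ![g.E i x, g.E j x, u, v] := by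
  have h : ∀ a : Fin 2 → Fin 4, (∏ k, eta (a k)) * w x (fun k => g.E (a k) x) *
      multiInteriorAt (q := 2) 2 (fun k => g.E (a k) x) (χ x) ![u, v] =
        eta (a 0) * eta (a 1) * w x ![g.E (a 0) x, g.E (a 1) x] *
          χ x ![g.E (a 0) x, g.E (a 1) x, u, v] := fun a => by
    rw [prod_eta_two, vec_two fun k => g.E (a k) x]
    rfl
  simp only [contract, ContinuousAlternatingMap.smul_apply, ContinuousAlternatingMap.sum_apply,
    smul_eq_mul, h, sum_tuple_succ, Fintype.sum_unique]
  norm_num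

theorem contract_three_one (w : Form M 3) (χ : Form M 4) (x : M) (u : TangentSpace (𝓡 4) x) :
    g.contract (p := 3) (q := 1) w χ x ![u] = (1 / 6 : ℝ) * ∑ i, ∑ j, ∑ k,
      eta i * eta j * eta k * w x ![g.E i x, g.E j x, g.E k x] *
        χ x ![g.E i x, g.E j x, g.E k x, u] := by
  have h : ∀ a : Fin 3 → Fin 4, (∏ k, eta (a k)) * w x (fun k => g.E (a k) x) *
      multiInteriorAt (q := 1) 3 (fun k => g.E (a k) x) (χ x) ![u] =
        eta (a 0) * eta (a 1) * eta (a 2) * w x ![g.E (a 0) x, g.E (a 1) x, g.E (a 2) x] *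
          χ x ![g.E (a 0) x, g.E (a 1) x, g.E (a 2) x, u] := fun a => by
    rw [prod_eta_three, vec_three fun k => g.E (a k) x]
    rfl
  simp only [contract, ContinuousAlternatingMap.smul_apply, ContinuousAlternatingMap.sum_apply,
    smul_eq_mul, h, sum_tuple_succ, Fintype.sum_unique]
  norm_num [Nat.factorial]
  rfl

/-! ### Components of the Hodge dual. -/

theorem star2_frame (w : Form M 2) (x : M) (c d : Fin 4) :
    g.star2 w x ![g.E c x, g.E d x] = (1 / 2 : ℝ) * ∑ i, ∑ j,
      eta i * eta j * w x ![g.E i x, g.E j x] * leviCivita i j c d := by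
  -- The degree cast in `hodge` vanishes definitionally, as `2 + 2` computes to `4`.
  have h : g.star2 w = g.contract (p := 2) (q := 2) w g.vol := rfl
  rw [h, contract_two_two]
  simp only [g.vol_frame x]

theorem star3_frame (w : Form M 3) (x : M) (d : Fin 4) :
    g.star3 w x ![g.E d x] = (1 / 6 : ℝ) * ∑ i, ∑ j, ∑ k, eta i * eta j * eta k *
      w x ![g.E i x, g.E j x, g.E k x] * leviCivita i j k d := by
  have h : g.star3 w = g.contract (p := 3) (q := 1) w g.vol := rfl
  rw [h, contract_three_one]
  simp only [g.vol_frame x]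

/-- Only the two orderings of the complementary index pair contribute, which absorbs the `1/2`. The
sign is the permutation sign times the product of the two `eta` factors. -/
theorem star2_frame_01 (w : Form M 2) (x : M) :
    g.star2 w x ![g.E 0 x, g.E 1 x] = w x ![g.E 2 x, g.E 3 x] := by
  -- `leviCivita` is integer-valued, so its table over finite indices is decidable.
  have h : ∀ i j, leviCivita i j 0 1 =
        if i = 2 ∧ j = 3 then 1 else
        if i = 3 ∧ j = 2 then -1 else 0 := by decide
  rw [star2_frame]
  simp [h, Fin.sum_univ_four, eta, two_form_swap (w x) (g.E 2 x) (g.E 3 x)]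
  ring

theorem star2_frame_02 (w : Form M 2) (x : M) :
    g.star2 w x ![g.E 0 x, g.E 2 x] = -w x ![g.E 1 x, g.E 3 x] := by
  have h : ∀ i j, leviCivita i j 0 2 =
        if i = 1 ∧ j = 3 then -1 else
        if i = 3 ∧ j = 1 then 1 else 0 := by decide
  rw [star2_frame]
  simp [h, Fin.sum_univ_four, eta, two_form_swap (w x) (g.E 1 x) (g.E 3 x)]
  ring

theorem star2_frame_03 (w : Form M 2) (x : M) :
    g.star2 w x ![g.E 0 x, g.E 3 x] = w x ![g.E 1 x, g.E 2 x] := by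
  have h : ∀ i j, leviCivita i j 0 3 =
        if i = 1 ∧ j = 2 then 1 else
        if i = 2 ∧ j = 1 then -1 else 0 := by decide
  rw [star2_frame]
  simp [h, Fin.sum_univ_four, eta, two_form_swap (w x) (g.E 1 x) (g.E 2 x)]
  ring

theorem star2_frame_12 (w : Form M 2) (x : M) :
    g.star2 w x ![g.E 1 x, g.E 2 x] = -w x ![g.E 0 x, g.E 3 x] := by
  have h : ∀ i j, leviCivita i j 1 2 =
        if i = 0 ∧ j = 3 then 1 else
        if i = 3 ∧ j = 0 then -1 else 0 := by decide
  rw [star2_frame]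
  simp [h, Fin.sum_univ_four, eta, two_form_swap (w x) (g.E 0 x) (g.E 3 x)]
  ring

theorem star2_frame_13 (w : Form M 2) (x : M) :
    g.star2 w x ![g.E 1 x, g.E 3 x] = w x ![g.E 0 x, g.E 2 x] := by
  have h : ∀ i j, leviCivita i j 1 3 =
        if i = 0 ∧ j = 2 then -1 else
        if i = 2 ∧ j = 0 then 1 else 0 := by decide
  rw [star2_frame]
  simp [h, Fin.sum_univ_four, eta, two_form_swap (w x) (g.E 0 x) (g.E 2 x)]
  ring

theorem star2_frame_23 (w : Form M 2) (x : M) :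
    g.star2 w x ![g.E 2 x, g.E 3 x] = -w x ![g.E 0 x, g.E 1 x] := by
  have h : ∀ i j, leviCivita i j 2 3 =
        if i = 0 ∧ j = 1 then 1 else
        if i = 1 ∧ j = 0 then -1 else 0 := by decide
  rw [star2_frame]
  simp [h, Fin.sum_univ_four, eta, two_form_swap (w x) (g.E 0 x) (g.E 1 x)]
  ring

/-- The six orderings of the complementary triple contribute equally and absorb the `1/6`. -/
theorem star3_frame_0 (w : Form M 3) (x : M) :
    g.star3 w x ![g.E 0 x] = -w x ![g.E 1 x, g.E 2 x, g.E 3 x] := by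
  have h : ∀ i j k, leviCivita i j k 0 =
        if i = 1 ∧ j = 2 ∧ k = 3 then -1 else
        if i = 1 ∧ j = 3 ∧ k = 2 then 1 else
        if i = 2 ∧ j = 1 ∧ k = 3 then 1 else
        if i = 2 ∧ j = 3 ∧ k = 1 then -1 else
        if i = 3 ∧ j = 1 ∧ k = 2 then -1 else
        if i = 3 ∧ j = 2 ∧ k = 1 then 1 else 0 := by decide
  rw [star3_frame]
  simp [h, Fin.sum_univ_four, eta]
  simp only [three_form_swap_left (w x) (g.E 1 x) (g.E 2 x), fun z => three_form_swap_right (w x) z (g.E 1 x) (g.E 2 x),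
    three_form_swap_left (w x) (g.E 1 x) (g.E 3 x), fun z => three_form_swap_right (w x) z (g.E 1 x) (g.E 3 x),
    fun z => three_form_swap_right (w x) z (g.E 2 x) (g.E 3 x)]
  ring

theorem star3_frame_1 (w : Form M 3) (x : M) :
    g.star3 w x ![g.E 1 x] = -w x ![g.E 0 x, g.E 2 x, g.E 3 x] := by
  have h : ∀ i j k, leviCivita i j k 1 =
        if i = 0 ∧ j = 2 ∧ k = 3 then 1 else
        if i = 0 ∧ j = 3 ∧ k = 2 then -1 else
        if i = 2 ∧ j = 0 ∧ k = 3 then -1 else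
        if i = 2 ∧ j = 3 ∧ k = 0 then 1 else
        if i = 3 ∧ j = 0 ∧ k = 2 then 1 else
        if i = 3 ∧ j = 2 ∧ k = 0 then -1 else 0 := by decide
  rw [star3_frame]
  simp [h, Fin.sum_univ_four, eta]
  simp only [three_form_swap_left (w x) (g.E 0 x) (g.E 2 x), fun z => three_form_swap_right (w x) z (g.E 0 x) (g.E 2 x),
    three_form_swap_left (w x) (g.E 0 x) (g.E 3 x), fun z => three_form_swap_right (w x) z (g.E 0 x) (g.E 3 x),
    fun z => three_form_swap_right (w x) z (g.E 2 x) (g.E 3 x)]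
  ring

theorem star3_frame_2 (w : Form M 3) (x : M) :
    g.star3 w x ![g.E 2 x] = w x ![g.E 0 x, g.E 1 x, g.E 3 x] := by
  have h : ∀ i j k, leviCivita i j k 2 =
        if i = 0 ∧ j = 1 ∧ k = 3 then -1 else
        if i = 0 ∧ j = 3 ∧ k = 1 then 1 else
        if i = 1 ∧ j = 0 ∧ k = 3 then 1 else
        if i = 1 ∧ j = 3 ∧ k = 0 then -1 else
        if i = 3 ∧ j = 0 ∧ k = 1 then -1 else
        if i = 3 ∧ j = 1 ∧ k = 0 then 1 else 0 := by decide
  rw [star3_frame]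
  simp [h, Fin.sum_univ_four, eta]
  simp only [three_form_swap_left (w x) (g.E 0 x) (g.E 1 x), fun z => three_form_swap_right (w x) z (g.E 0 x) (g.E 1 x),
    three_form_swap_left (w x) (g.E 0 x) (g.E 3 x), fun z => three_form_swap_right (w x) z (g.E 0 x) (g.E 3 x),
    fun z => three_form_swap_right (w x) z (g.E 1 x) (g.E 3 x)]
  ring

theorem star3_frame_3 (w : Form M 3) (x : M) :
    g.star3 w x ![g.E 3 x] = -w x ![g.E 0 x, g.E 1 x, g.E 2 x] := by
  have h : ∀ i j k, leviCivita i j k 3 =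
        if i = 0 ∧ j = 1 ∧ k = 2 then 1 else
        if i = 0 ∧ j = 2 ∧ k = 1 then -1 else
        if i = 1 ∧ j = 0 ∧ k = 2 then -1 else
        if i = 1 ∧ j = 2 ∧ k = 0 then 1 else
        if i = 2 ∧ j = 0 ∧ k = 1 then 1 else
        if i = 2 ∧ j = 1 ∧ k = 0 then -1 else 0 := by decide
  rw [star3_frame]
  simp [h, Fin.sum_univ_four, eta]
  simp only [three_form_swap_left (w x) (g.E 0 x) (g.E 1 x), fun z => three_form_swap_right (w x) z (g.E 0 x) (g.E 1 x),
    three_form_swap_left (w x) (g.E 0 x) (g.E 2 x), fun z => three_form_swap_right (w x) z (g.E 0 x) (g.E 2 x),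
    fun z => three_form_swap_right (w x) z (g.E 1 x) (g.E 2 x)]
  ring

/-! ### The quadratic identity. -/

theorem iota_frame_one (α β : Fin 4) (w : Form M 2) (x : M) :
    g.iota α w x ![g.E β x] = w x ![g.E α x, g.E β x] := rfl

theorem low_frame (α β : Fin 4) (x : M) :
    g.low α x ![g.E β x] = if α = β then eta α else 0 := by
  have h : g.low α x ![g.E β x] = eta α * g.up α x ![g.E β x] := rfl
  rw [h, g.dual]
  split_ifs <;> simp

theorem star3_add (w χ : Form M 3) : g.star3 (w + χ) = g.star3 w + g.star3 χ := by
  refine g.ext_frame fun x γ => ?_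
  have h : ∀ (p : ℕ) (w χ : Form M p) (v), (w + χ) x v = w x v + χ x v := fun _ _ _ _ => rfl
  simp only [h, star3_frame, ← mul_add, ← Finset.sum_add_distrib]
  simp only [mul_add, add_mul]

theorem star3_sum {ι : Type*} (s : Finset ι) (W : ι → Form M 3) :
    g.star3 (∑ β ∈ s, W β) = ∑ β ∈ s, g.star3 (W β) :=
  map_sum (AddMonoidHom.mk' g.star3 g.star3_add) W s

/-- The quadratic identity behind the energy-momentum currents, for a single two-form. -/
theorem current_two_form (c : ℝ) (F G : Form M 2) (hG : G = c • F) (α : Fin 4) :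
    (1 / 2 : ℝ) • g.star3 (wedge (p := 2) (q := 1) G (g.iota α (g.star2 F)) -
          wedge (p := 1) (q := 2) (g.iota α G) (g.star2 F)) +
        (fun x => ((1 / 2 : ℝ) * g.inner G F x) • g.low α x) =
      g.contract (p := 2) (q := 1) G (wedge (g.low α) F) := by
  refine g.ext_frame fun x γ => ?_
  have hs : ∀ (w χ : Form M 3) (v), (w - χ) x v = w x v - χ x v := fun _ _ _ => rfl
  -- Proportionality leaves only the components of `F` and the constant `c` to compute with.
  have hc : ∀ v, G x v = c * F x v := fun v => by rw [hG]; rfl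
  have hl : ∀ w : Form M 1, ((1 / 2 : ℝ) • w +
      fun x => ((1 / 2 : ℝ) * g.inner G F x) • g.low α x) x ![g.E γ x] =
        (1 / 2 : ℝ) * w x ![g.E γ x] + (1 / 2 : ℝ) * g.inner G F x * g.low α x ![g.E γ x] :=
    fun _ => rfl
  rw [hl, inner_two]
  erw [contract_two_one]
  have hw : ∀ a b : Fin 4, (wedge (g.low α) F) x ![g.E a x, g.E b x, g.E γ x] = _ := fun a b =>
    wedge_one_two_apply _ _ _ _ _ _
  erw [Finset.sum_congr rfl fun a _ => Finset.sum_congr rfl fun b _ => congrArg _ (hw a b)]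
  simp only [low_frame, hc]
  -- In each of the sixteen cases `(γ, α)` both sides become polynomials in `c` and the six
  -- independent components of `F`.
  fin_cases γ <;> simp only [Fin.zero_eta, Fin.mk_one, Fin.reduceFinMk] <;>
  simp only [star3_frame_0, star3_frame_1, star3_frame_2,
    star3_frame_3, hs, wedge_one_two_apply, wedge_two_one_apply,
    iota_frame_one, hc] <;>
  fin_cases α <;>
  simp [two_form_self, Fin.sum_univ_four, eta,
      star2_frame_01, star2_frame_02, star2_frame_03, star2_frame_12, star2_frame_13, star2_frame_23,
      two_form_swap (F x) (g.E 0 x) (g.E 1 x),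
      two_form_swap (F x) (g.E 0 x) (g.E 2 x),
      two_form_swap (F x) (g.E 0 x) (g.E 3 x),
      two_form_swap (F x) (g.E 1 x) (g.E 2 x),
      two_form_swap (F x) (g.E 1 x) (g.E 3 x),
      two_form_swap (F x) (g.E 2 x) (g.E 3 x), two_form_swap (g.star2 F x) (g.E 0 x) (g.E 1 x),
      two_form_swap (g.star2 F x) (g.E 0 x) (g.E 2 x),
      two_form_swap (g.star2 F x) (g.E 0 x) (g.E 3 x),
      two_form_swap (g.star2 F x) (g.E 1 x) (g.E 2 x),
      two_form_swap (g.star2 F x) (g.E 1 x) (g.E 3 x),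
      two_form_swap (g.star2 F x) (g.E 2 x) (g.E 3 x)] <;> ring

/-! ### Lorenz gauge and summation over the potentials. -/

theorem extd_low (β : Fin 4) : extd (g.low β) = eta β • extd (g.up β) := by
  rw [low, extd_smul]

/-- In the Lorenz gauge, only the quadratic part of the energy-momentum currents remains. -/
theorem gravCurrent_of_lorenz (h : ∀ β, g.deltaLow β = 0) (α : Fin 4) :
    g.gravCurrent α = (1 / 2 : ℝ) • g.star3 (∑ β,
      (wedge (p := 2) (q := 1) (extd (g.low β)) (g.iota α (g.star2 (extd (g.up β))))
        - wedge (p := 1) (q := 2) (g.iota α (extd (g.low β))) (g.star2 (extd (g.up β))))) := by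
  -- Raising the index multiplies by the constant `eta β`, which commutes with the codifferential.
  have hU : ∀ β, g.deltaUp β = 0 := fun β => by
    rw [deltaUp, up_eq, codiff_smul]
    exact (congrArg _ (h β)).trans (smul_zero _)
  have hI : ∀ β, g.iota β (0 : Form M 1) = 0 := fun β => rfl
  simp only [gravCurrent, h, hU, extd_zero, hI, zero_wedge, smul_zero, add_zero, sub_zero,
    Finset.sum_const_zero]

/-- In the Lorenz gauge, the Laplace-Beltrami operator reduces to `δd` on potentials. -/
theorem box_of_lorenz {α : Fin 4} (h : g.deltaLow α = 0) :
    g.box (p := 0) (by norm_num) (g.low α) =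
      g.codiff (p := 1) (by norm_num) (extd (g.low α)) := by
  have h' : g.codiff (p := 0) (by norm_num) (g.low α) = 0 := h
  rw [box, h', extd_zero]
  exact zero_add _

/-- The energy-momentum of the potentials in terms of the contraction `i_{dg_β}(g_α ∧ dg^β)`. -/
theorem current_sum (α : Fin 4) :
    (1 / 2 : ℝ) • g.star3 (∑ β,
        (wedge (p := 2) (q := 1) (extd (g.low β)) (g.iota α (g.star2 (extd (g.up β))))
          - wedge (p := 1) (q := 2) (g.iota α (extd (g.low β))) (g.star2 (extd (g.up β)))))
      + (fun x => ((1 / 2 : ℝ) * ∑ β, g.inner (extd (g.low β)) (extd (g.up β)) x) • g.low α x) =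
      ∑ β, g.contract (p := 2) (q := 1) (extd (g.low β)) (wedge (g.low α) (extd (g.up β))) := by
  -- The single-form identity applies to each `β` with `F = dg^β`, `G = dg_β` and `c = eta β`.
  simp only [← g.current_two_form _ _ _ (g.extd_low _), Finset.sum_add_distrib, star3_sum,
    Finset.smul_sum]
  congr 1
  funext x
  simp only [Finset.sum_apply, Finset.mul_sum, Finset.sum_smul]

end Cobase

end Manifold

end ProcaGravity

end

theorem mainTheorem4 {M : Type*} [TopologicalSpace M]
    [ChartedSpace (EuclideanSpace ℝ (Fin 4)) M] [IsManifold (𝓡 4) ∞ M]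
    (g : ProcaGravity.Cobase M) (J : Fin 4 → ProcaGravity.Form M 1)
    (hJ : ∀ α, ProcaGravity.IsSmooth (J α))
    (hLorenz : ∀ α, g.codiff (p := 0) (by norm_num) (g.low α) = 0) (α : Fin 4) :
    g.codiff (p := 1) (by norm_num) (ProcaGravity.extd (g.low α)) = g.gravCurrent α + J α ↔
      g.box (p := 0) (by norm_num) (g.low α)
          + (fun x => ((1 / 2 : ℝ) *
              ∑ β, g.inner (ProcaGravity.extd (g.low β)) (ProcaGravity.extd (g.up β)) x) •
                g.low α x)
        = ∑ β, g.contract (p := 2) (q := 1) (ProcaGravity.extd (g.low β))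
              (ProcaGravity.wedge (g.low α) (ProcaGravity.extd (g.up β))) + J α := by
  -- The Proca equation is now the field equation with `½⟨dg_β|dg^β⟩g_α` added to both sides, and
  -- this term cancels.
  rw [g.gravCurrent_of_lorenz hLorenz α, g.box_of_lorenz (hLorenz α), ← g.current_sum α,
    add_right_comm _ _ (J α), add_left_inj]
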